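/- Consider the discrete-time feedback system, $t=0,1,2,\dots$, \[ x[t+1]=Ax[t]+Bu[t]+\delta_x[t],\quad y[t]=Cx[t]+\delta_y[t],\quad \xi[t+1]=A_k\xi[t]+B_ky[t],\quad u[t]=C_k\xi[t]+D_ky[t]+\delta_u[t], \] with real matrices, $x[t]\in\mathbb R^n$, $u[t]\in\mathbb R^m$, $y[t]\in\mathbb R^p$, $\xi[t]\in\mathbb R^q$, plant $\mathbf G=C(zI-A)^{-1}B$ and controller $\mathbf K=C_k(zI-A_k)^{-1}B_k+D_k$. A real square matrix is stable if all its complex eigenvalues lie in the open unit disk; $(A,B)$ is stabilizable if $A+BF$ is stable for some real $F$, and $(A,C)$ is detectable if $A+LC$ is stable for some real $L$. $\mathcal{RH}_\infty$ denotes the real-rational proper transfer matrices all of whose poles lie in the open unit disk. The closed-loop responses $\mathbf\Phi_{ab}$ from $\delta_b$ to $a$ ($a,b\in\{x,y,u\}$) are \[ \begin{aligned} &\mathbf\Phi_{xx}=(zI-A-B\mathbf KC)^{-1}, && \mathbf\Phi_{xy}=\mathbf\Phi_{xx}B\mathbf K, && \mathbf\Phi_{xu}=\mathbf\Phi_{xx}B,\\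 &\mathbf\Phi_{yx}=C\mathbf\Phi_{xx}, && \mathbf\Phi_{yy}=C\mathbf\Phi_{xx}B\mathbf K+I, && \mathbf\Phi_{yu}=C\mathbf\Phi_{xx}B,\\ &\mathbf\Phi_{ux}=\mathbf KC\mathbf\Phi_{xx}, && \mathbf\Phi_{uy}=\mathbf K(C\mathbf\Phi_{xx}B\mathbf K+I), && \mathbf\Phi_{uu}=\mathbf KC\mathbf\Phi_{xx}B+I, \end{aligned} \] and for two disturbances and two signals, $(\delta_b,\delta_{b'})\to(a,a')$ denotes the transfer matrix $\begin{bmatrix}\mathbf\Phi_{ab}&\mathbf\Phi_{ab'}\\ \mathbf\Phi_{a'b}&\mathbf\Phi_{a'b'}\end{bmatrix}$. The controller $\mathbf K$ internally stabilizes $\mathbf G$ if the closed loop is well-posed (all closed-loop responses are well defined and proper) and, for $\delta_x=0$, $\delta_y=0$, $\delta_u=0$, the states $(x[t],\xi[t])$ converge to zero as $t\to\infty$ for all initial states. Assume that $(A,B)$ and $(A_k,B_k)$ are stabilizable and that $(A,C)$ and $(A_k,C_k)$ are detectable. Then the following are equivalent: (1) $\mathbf K$ internally stabilizes $\mathbf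 G$; (2) $(\delta_x,\delta_y)\to(y,u)$ is in $\mathcal{RH}_\infty$; (3) $(\delta_x,\delta_y)\to(x,u)$ is in $\mathcal{RH}_\infty$; (4) $(\delta_y,\delta_u)\to(y,u)$ is in $\mathcal{RH}_\infty$; (5) $(\delta_y,\delta_u)\to(x,u)$ is in $\mathcal{RH}_\infty$. Moreover, for none of the other five groups $(\delta_x,\delta_y)\to(x,y)$, $(\delta_y,\delta_u)\to(x,y)$, $(\delta_x,\delta_u)\to(x,y)$, $(\delta_x,\delta_u)\to(y,u)$, $(\delta_x,\delta_u)\to(x,u)$ is membership in $\mathcal{RH}_\infty$ sufficient for internal stability: for each of them there is a system with $n,m,p,q\ge 1$ that satisfies the assumption above, for which the group is in $\mathcal{RH}_\infty$, but $\mathbf K$ does not internally stabilize $\mathbf G$. -/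

import Mathlib

open Matrix

/-- The feedback interconnection of a strictly proper discrete-time plant `(A, B, C)` with a
controller `(Ak, Bk, Ck, Dk)`: `n` plant states, `m` inputs, `p` measurements and
`q` controller states. -/
structure FeedbackSystem (n m p q : ℕ) where
  A : Matrix (Fin n) (Fin n) ℝ
  B : Matrix (Fin n) (Fin m) ℝ
  C : Matrix (Fin p) (Fin n) ℝ
  Ak : Matrix (Fin q) (Fin q) ℝ
  Bk : Matrix (Fin q) (Fin p) ℝ
  Ck : Matrix (Fin m) (Fin q) ℝ
  Dk : Matrix (Fin m) (Fin p) ℝ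

/-- A real square matrix is (asymptotically, in discrete time) stable if all its complex
eigenvalues lie in the open unit disk. -/
def IsStableMatrix {n : ℕ} (A : Matrix (Fin n) (Fin n) ℝ) : Prop :=
  ∀ z ∈ spectrum ℂ (A.map (algebraMap ℝ ℂ)), ‖z‖ < 1

/-- `(A, B)` is stabilizable: some state feedback makes `A + B F` stable. -/
def Stabilizable {n m : ℕ} (A : Matrix (Fin n) (Fin n) ℝ) (B : Matrix (Fin n) (Fin m) ℝ) :
    Prop :=
  ∃ F : Matrix (Fin m) (Fin n) ℝ, IsStableMatrix (A + B * F)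

/-- `(A, C)` is detectable: some output injection makes `A + L C` stable. -/
def Detectable {n p : ℕ} (A : Matrix (Fin n) (Fin n) ℝ) (C : Matrix (Fin p) (Fin n) ℝ) :
    Prop :=
  ∃ L : Matrix (Fin n) (Fin p) ℝ, IsStableMatrix (A + L * C)

/-- A real-rational function of `z` is proper. -/
def IsProperRat (f : RatFunc ℝ) : Prop := f.num.degree ≤ f.denom.degree

/-- All poles of a real-rational function (the complex zeros of its reduced denominator) lie in
the open unit disk. -/
def HasStablePoles (f : RatFunc ℝ) : Prop :=
  ∀ z : ℂ, Polynomial.aeval z f.denom = 0 → ‖z‖ < 1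

/-- A transfer matrix is proper if all its entries are. -/
def IsProper {ι κ : Type} (T : Matrix ι κ (RatFunc ℝ)) : Prop :=
  ∀ i j, IsProperRat (T i j)

/-- Membership in `RH∞`: real-rational, proper and stable transfer matrices. -/
def MemRHInf {ι κ : Type} (T : Matrix ι κ (RatFunc ℝ)) : Prop :=
  ∀ i j, IsProperRat (T i j) ∧ HasStablePoles (T i j)

/-- A constant real matrix regarded as a transfer matrix. -/
noncomputable def constTM {ι κ : Type} (M : Matrix ι κ ℝ) : Matrix ι κ (RatFunc ℝ) :=
  M.map (algebraMap ℝ (RatFunc ℝ))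

namespace FeedbackSystem

variable {n m p q : ℕ} (S : FeedbackSystem n m p q)

/-- Both the plant and the controller realization are stabilizable and detectable. -/
def StabilizableDetectable : Prop :=
  Stabilizable S.A S.B ∧ Stabilizable S.Ak S.Bk ∧ Detectable S.A S.C ∧ Detectable S.Ak S.Ck

/-- The controller transfer matrix `K = Ck (zI - Ak)⁻¹ Bk + Dk`. -/
noncomputable def K : Matrix (Fin m) (Fin p) (RatFunc ℝ) :=
  constTM S.Ck * ((RatFunc.X : RatFunc ℝ) • (1 : Matrix (Fin q) (Fin q) (RatFunc ℝ))
    - constTM S.Ak)⁻¹ * constTM S.Bk + constTM S.Dk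

/-- The matrix `zI - A - B K C`. -/
noncomputable def closedLoopPencil : Matrix (Fin n) (Fin n) (RatFunc ℝ) :=
  (RatFunc.X : RatFunc ℝ) • (1 : Matrix (Fin n) (Fin n) (RatFunc ℝ))
    - constTM S.A - constTM S.B * S.K * constTM S.C

/-! The closed-loop responses; `Φab` is the map from the disturbance `δb` to the signal `a`. -/

/-- The response from `δx` to `x`. -/
noncomputable def Φxx : Matrix (Fin n) (Fin n) (RatFunc ℝ) := S.closedLoopPencil⁻¹

/-- The response from `δy` to `x`. -/
noncomputable def Φxy : Matrix (Fin n) (Fin p) (RatFunc ℝ) := S.Φxx * constTM S.B * S.K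

/-- The response from `δu` to `x`. -/
noncomputable def Φxu : Matrix (Fin n) (Fin m) (RatFunc ℝ) := S.Φxx * constTM S.B

/-- The response from `δx` to `y`. -/
noncomputable def Φyx : Matrix (Fin p) (Fin n) (RatFunc ℝ) := constTM S.C * S.Φxx

/-- The response from `δy` to `y`. -/
noncomputable def Φyy : Matrix (Fin p) (Fin p) (RatFunc ℝ) :=
  constTM S.C * S.Φxx * constTM S.B * S.K + 1

/-- The response from `δu` to `y`. -/
noncomputable def Φyu : Matrix (Fin p) (Fin m) (RatFunc ℝ) := constTM S.C * S.Φxx * constTM S.B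

/-- The response from `δx` to `u`. -/
noncomputable def Φux : Matrix (Fin m) (Fin n) (RatFunc ℝ) := S.K * constTM S.C * S.Φxx

/-- The response from `δy` to `u`. -/
noncomputable def Φuy : Matrix (Fin m) (Fin p) (RatFunc ℝ) :=
  S.K * (constTM S.C * S.Φxx * constTM S.B * S.K + 1)

/-- The response from `δu` to `u`. -/
noncomputable def Φuu : Matrix (Fin m) (Fin m) (RatFunc ℝ) :=
  S.K * constTM S.C * S.Φxx * constTM S.B + 1

/-- Well-posedness: all closed-loop transfer matrices are well defined and proper. -/
def WellPosed : Prop :=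
  IsUnit S.closedLoopPencil ∧
    IsProper S.Φxx ∧ IsProper S.Φxy ∧ IsProper S.Φxu ∧
    IsProper S.Φyx ∧ IsProper S.Φyy ∧ IsProper S.Φyu ∧
    IsProper S.Φux ∧ IsProper S.Φuy ∧ IsProper S.Φuu

/-- The signals `(x, ξ, u, y)` solve the closed-loop equations with disturbances
`(δx, δy, δu)`. -/
structure IsTrajectory (δx : ℕ → Fin n → ℝ) (δy : ℕ → Fin p → ℝ) (δu : ℕ → Fin m → ℝ)
    (x : ℕ → Fin n → ℝ) (ξ : ℕ → Fin q → ℝ) (u : ℕ → Fin m → ℝ) (y : ℕ → Fin p → ℝ) :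
    Prop where
  plant_state : ∀ t, x (t + 1) = S.A *ᵥ x t + S.B *ᵥ u t + δx t
  plant_output : ∀ t, y t = S.C *ᵥ x t + δy t
  controller_state : ∀ t, ξ (t + 1) = S.Ak *ᵥ ξ t + S.Bk *ᵥ y t
  controller_output : ∀ t, u t = S.Ck *ᵥ ξ t + S.Dk *ᵥ y t + δu t

/-- `K` internally stabilizes `G`: the closed loop is well-posed and, without disturbances, the
states `(x, ξ)` converge to zero from every initial state. -/
def InternallyStable : Prop :=
  S.WellPosed ∧
    ∀ (x : ℕ → Fin n → ℝ) (ξ : ℕ → Fin q → ℝ) (u : ℕ → Fin m → ℝ) (y : ℕ → Fin p → ℝ),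
      S.IsTrajectory 0 0 0 x ξ u y →
        Filter.Tendsto (fun t => (x t, ξ t)) Filter.atTop (nhds (0, 0))

/-! The nine groups of four closed-loop responses; `groupABtoCD` is the transfer matrix from the
disturbances `(δA, δB)` to the signals `(C, D)`. -/

/-- `(δx, δy) → (x, y)` -/
noncomputable def groupXYtoXY : Matrix (Fin n ⊕ Fin p) (Fin n ⊕ Fin p) (RatFunc ℝ) :=
  fromBlocks S.Φxx S.Φxy S.Φyx S.Φyy

/-- `(δx, δy) → (y, u)` -/
noncomputable def groupXYtoYU : Matrix (Fin p ⊕ Fin m) (Fin n ⊕ Fin p) (RatFunc ℝ) :=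
  fromBlocks S.Φyx S.Φyy S.Φux S.Φuy

/-- `(δx, δy) → (x, u)` -/
noncomputable def groupXYtoXU : Matrix (Fin n ⊕ Fin m) (Fin n ⊕ Fin p) (RatFunc ℝ) :=
  fromBlocks S.Φxx S.Φxy S.Φux S.Φuy

/-- `(δy, δu) → (x, y)` -/
noncomputable def groupYUtoXY : Matrix (Fin n ⊕ Fin p) (Fin p ⊕ Fin m) (RatFunc ℝ) :=
  fromBlocks S.Φxy S.Φxu S.Φyy S.Φyu

/-- `(δy, δu) → (y, u)` -/
noncomputable def groupYUtoYU : Matrix (Fin p ⊕ Fin m) (Fin p ⊕ Fin m) (RatFunc ℝ) :=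
  fromBlocks S.Φyy S.Φyu S.Φuy S.Φuu

/-- `(δy, δu) → (x, u)` -/
noncomputable def groupYUtoXU : Matrix (Fin n ⊕ Fin m) (Fin p ⊕ Fin m) (RatFunc ℝ) :=
  fromBlocks S.Φxy S.Φxu S.Φuy S.Φuu

/-- `(δx, δu) → (x, y)` -/
noncomputable def groupXUtoXY : Matrix (Fin n ⊕ Fin p) (Fin n ⊕ Fin m) (RatFunc ℝ) :=
  fromBlocks S.Φxx S.Φxu S.Φyx S.Φyu

/-- `(δx, δu) → (y, u)` -/
noncomputable def groupXUtoYU : Matrix (Fin p ⊕ Fin m) (Fin n ⊕ Fin m) (RatFunc ℝ) :=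
  fromBlocks S.Φyx S.Φyu S.Φux S.Φuu

/-- `(δx, δu) → (x, u)` -/
noncomputable def groupXUtoXU : Matrix (Fin n ⊕ Fin m) (Fin n ⊕ Fin m) (RatFunc ℝ) :=
  fromBlocks S.Φxx S.Φxu S.Φux S.Φuu

end FeedbackSystem

/-!
Write the closed loop as one linear recursion `(x, ξ)[t+1] = 𝒜 (x, ξ)[t]` with
`𝒜 = closedLoopMatrix`. The closed-loop pencil `zI - A - B K C` is the Schur complement of
`zI - Ak` in `zI - 𝒜`, so all nine responses are assembled from constant matrices and blocks of
the resolvent `(zI - 𝒜)⁻¹` (`inv_pencil_closedLoopMatrix`, `entriesIn_responses`). Resolvents are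
proper, hence the loop is always well-posed, and internal stability means exactly that `𝒜` is
stable (`internallyStable_iff_schurStable`). If `𝒜` is stable then its resolvent, and with it every
response, is in `RH∞`.

For the converse, the definitions of the responses alone show that each of the groups
`(δx, δy) → (y, u)`, `(δx, δy) → (x, u)` and `(δy, δu) → (x, u)` in `RH∞`
forces `(δy, δu) → (y, u)` into `RH∞`. That group has, up to a constant, the realization
`(𝒜, closedLoopInput, closedLoopOutput)`, which is stabilizable and detectable because plant and
controller are. A stabilizable and detectable realization of an `RH∞` transfer matrix is stable
(`SchurStable.of_entriesIn_transfer`): output injection and state feedback recover the resolvent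
from the transfer matrix, and a resolvent `R` in `RH∞` has `det R = 1 / charpoly 𝒜` in `RH∞`.

The five other groups are refuted together by a two-channel loop in which `B K = 0` and `K C = 0`
(`hiddenController`): the plant lives in the first channel, an unstable controller in the second.
Its instability is visible only in `Φuy = K`, which none of these groups contains.
-/

/-! ### Subalgebras of rational functions -/

theorem isProperRat_iff_intDegree_nonpos (f : RatFunc ℝ) : IsProperRat f ↔ f.intDegree ≤ 0 := by
  rw [RatFunc.intDegree, sub_nonpos, Nat.cast_le]
  exact ⟨Polynomial.natDegree_le_natDegree, fun h =>
    Polynomial.degree_le_of_natDegree_le h |>.trans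
      (Polynomial.degree_eq_natDegree f.denom_ne_zero).ge⟩

/-- The proper rational functions. -/
noncomputable def properSubalgebra : Subalgebra ℝ (RatFunc ℝ) where
  carrier := {f | IsProperRat f}
  mul_mem' {f g} hf hg := by
    simp only [Set.mem_ofPred_eq, isProperRat_iff_intDegree_nonpos] at *
    by_cases hf0 : f = 0
    · simp [hf0]
    by_cases hg0 : g = 0
    · simp [hg0]
    rw [RatFunc.intDegree_mul hf0 hg0]
    lia
  add_mem' {f g} hf hg := by
    simp only [Set.mem_ofPred_eq, isProperRat_iff_intDegree_nonpos] at *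
    by_cases hg0 : g = 0
    · simpa [hg0] using hf
    by_cases hfg : f + g = 0
    · simp [hfg]
    exact (RatFunc.intDegree_add_le hg0 hfg).trans (max_le hf hg)
  algebraMap_mem' r := by
    simp [isProperRat_iff_intDegree_nonpos, RatFunc.algebraMap_eq_C]

theorem HasStablePoles.of_denom_dvd {f : RatFunc ℝ} {p : Polynomial ℝ} (hdvd : f.denom ∣ p)
    (hp : ∀ z : ℂ, Polynomial.aeval z p = 0 → ‖z‖ < 1) : HasStablePoles f := by
  intro z hz
  obtain ⟨c, rfl⟩ := hdvd
  exact hp z (by simp [hz])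

/-- The rational functions with all poles in the open unit disk. -/
noncomputable def stableSubalgebra : Subalgebra ℝ (RatFunc ℝ) where
  carrier := {f | HasStablePoles f}
  mul_mem' {f g} hf hg := HasStablePoles.of_denom_dvd (RatFunc.denom_mul_dvd f g) fun z hz => by
    rw [map_mul, mul_eq_zero] at hz
    exact hz.elim (hf z) (hg z)
  add_mem' {f g} hf hg := HasStablePoles.of_denom_dvd (RatFunc.denom_add_dvd f g) fun z hz => by
    rw [map_mul, mul_eq_zero] at hz
    exact hz.elim (hf z) (hg z)
  algebraMap_mem' r := by
    intro z hz
    simp [RatFunc.algebraMap_eq_C] at hz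

/-- The scalar ring `RH∞`. -/
noncomputable def rhInf : Subalgebra ℝ (RatFunc ℝ) := properSubalgebra ⊓ stableSubalgebra

/-- All entries of the transfer matrix `T` lie in the subalgebra `P`. -/
def EntriesIn (P : Subalgebra ℝ (RatFunc ℝ)) {ι κ : Type} (T : Matrix ι κ (RatFunc ℝ)) : Prop :=
  ∀ i j, T i j ∈ P

namespace EntriesIn

variable {P : Subalgebra ℝ (RatFunc ℝ)} {ι κ ν μ : Type}

theorem add {S T : Matrix ι κ (RatFunc ℝ)} (hS : EntriesIn P S) (hT : EntriesIn P T) :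
    EntriesIn P (S + T) := fun i j => P.add_mem (hS i j) (hT i j)

theorem sub {S T : Matrix ι κ (RatFunc ℝ)} (hS : EntriesIn P S) (hT : EntriesIn P T) :
    EntriesIn P (S - T) := fun i j => P.sub_mem (hS i j) (hT i j)

theorem mul [Fintype κ] {S : Matrix ι κ (RatFunc ℝ)} {T : Matrix κ ν (RatFunc ℝ)}
    (hS : EntriesIn P S) (hT : EntriesIn P T) : EntriesIn P (S * T) :=
  fun i j => P.sum_mem fun k _ => P.mul_mem (hS i k) (hT k j)

theorem const (M : Matrix ι κ ℝ) : EntriesIn P (constTM M) := fun i j => P.algebraMap_mem (M i j)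

theorem zero : EntriesIn P (0 : Matrix ι κ (RatFunc ℝ)) := fun _ _ => P.zero_mem

theorem one [DecidableEq ι] : EntriesIn P (1 : Matrix ι ι (RatFunc ℝ)) := fun i j => by
  rw [one_apply]
  split_ifs
  exacts [P.one_mem, P.zero_mem]

theorem det_mem [Fintype ι] [DecidableEq ι] {T : Matrix ι ι (RatFunc ℝ)} (hT : EntriesIn P T) :
    T.det ∈ P := by
  rw [det_apply]
  exact P.sum_mem fun σ _ => P.toSubring.zsmul_mem (P.prod_mem fun i _ => hT _ _) _

theorem fromBlocks_iff {A : Matrix ι κ (RatFunc ℝ)} {B : Matrix ι ν (RatFunc ℝ)}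
    {C : Matrix μ κ (RatFunc ℝ)} {D : Matrix μ ν (RatFunc ℝ)} :
    EntriesIn P (fromBlocks A B C D) ↔
      EntriesIn P A ∧ EntriesIn P B ∧ EntriesIn P C ∧ EntriesIn P D := by
  simp only [EntriesIn, Sum.forall, fromBlocks_apply₁₁, fromBlocks_apply₁₂, fromBlocks_apply₂₁,
    fromBlocks_apply₂₂, forall_and]
  tauto

end EntriesIn

theorem memRHInf_fromBlocks_iff {ι κ ν μ : Type} {A : Matrix ι κ (RatFunc ℝ)}
    {B : Matrix ι ν (RatFunc ℝ)} {C : Matrix μ κ (RatFunc ℝ)} {D : Matrix μ ν (RatFunc ℝ)} :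
    MemRHInf (fromBlocks A B C D) ↔
      EntriesIn rhInf A ∧ EntriesIn rhInf B ∧ EntriesIn rhInf C ∧ EntriesIn rhInf D :=
  EntriesIn.fromBlocks_iff (P := rhInf)

section constTM

variable {ι κ ν μ : Type}

theorem constTM_add (M N : Matrix ι κ ℝ) : constTM (M + N) = constTM M + constTM N :=
  Matrix.map_add _ (map_add _) _ _

theorem constTM_mul [Fintype κ] (M : Matrix ι κ ℝ) (N : Matrix κ ν ℝ) :
    constTM (M * N) = constTM M * constTM N :=
  Matrix.map_mul

theorem constTM_zero : constTM (0 : Matrix ι κ ℝ) = 0 :=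
  Matrix.map_zero _ (map_zero _)

theorem constTM_one [DecidableEq ι] : constTM (1 : Matrix ι ι ℝ) = 1 :=
  Matrix.map_one _ (map_zero _) (map_one _)

theorem constTM_fromBlocks (A : Matrix ι κ ℝ) (B : Matrix ι ν ℝ) (C : Matrix μ κ ℝ)
    (D : Matrix μ ν ℝ) :
    constTM (fromBlocks A B C D) =
      fromBlocks (constTM A) (constTM B) (constTM C) (constTM D) :=
  fromBlocks_map _ _ _ _ _

end constTM

/-! ### Stable matrices and their resolvents -/

section Resolvent

variable {ι κ ν : Type} [Fintype ι] [DecidableEq ι]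

/-- Stability of a real square matrix over an arbitrary finite index type, phrased through the
roots of the characteristic polynomial. -/
def SchurStable (A : Matrix ι ι ℝ) : Prop :=
  ∀ z : ℂ, Polynomial.aeval z A.charpoly = 0 → ‖z‖ < 1

theorem mem_spectrum_map_iff_aeval_charpoly (A : Matrix ι ι ℝ) (z : ℂ) :
    z ∈ spectrum ℂ (A.map (algebraMap ℝ ℂ)) ↔ Polynomial.aeval z A.charpoly = 0 := by
  rw [mem_spectrum_iff_isRoot_charpoly, charpoly_map, Polynomial.IsRoot,
    Polynomial.eval_map_algebraMap]

theorem isStableMatrix_iff_schurStable {n : ℕ} (A : Matrix (Fin n) (Fin n) ℝ) :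
    IsStableMatrix A ↔ SchurStable A :=
  forall_congr' fun z => by rw [mem_spectrum_map_iff_aeval_charpoly]

theorem SchurStable.fromBlocks_diagonal [Fintype κ] [DecidableEq κ] {A : Matrix ι ι ℝ}
    {D : Matrix κ κ ℝ} (hA : SchurStable A) (hD : SchurStable D) :
    SchurStable (fromBlocks A 0 0 D) := by
  intro z hz
  rw [charpoly_fromBlocks_zero₁₂, map_mul, mul_eq_zero] at hz
  exact hz.elim (hA z) (hD z)

/-- The pencil `zI - A`. -/
noncomputable def pencil (A : Matrix ι ι ℝ) : Matrix ι ι (RatFunc ℝ) :=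
  (RatFunc.X : RatFunc ℝ) • (1 : Matrix ι ι (RatFunc ℝ)) - constTM A

theorem pencil_eq_map_charmatrix (A : Matrix ι ι ℝ) :
    pencil A = (algebraMap (Polynomial ℝ) (RatFunc ℝ)).mapMatrix (charmatrix A) := by
  ext i j
  by_cases h : i = j
  · subst h
    simp [pencil, constTM, charmatrix_apply_eq, RatFunc.algebraMap_eq_C]
  · simp [pencil, constTM, charmatrix_apply_ne, h, RatFunc.algebraMap_eq_C]

theorem det_pencil (A : Matrix ι ι ℝ) :
    (pencil A).det = algebraMap (Polynomial ℝ) (RatFunc ℝ) A.charpoly := by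
  rw [pencil_eq_map_charmatrix, ← RingHom.map_det, charpoly]

theorem det_pencil_ne_zero (A : Matrix ι ι ℝ) : (pencil A).det ≠ 0 := by
  rw [det_pencil]
  exact RatFunc.algebraMap_ne_zero A.charpoly_monic.ne_zero

theorem isUnit_det_pencil (A : Matrix ι ι ℝ) : IsUnit (pencil A).det :=
  (det_pencil_ne_zero A).isUnit

theorem isUnit_pencil (A : Matrix ι ι ℝ) : IsUnit (pencil A) :=
  (isUnit_iff_isUnit_det _).2 (isUnit_det_pencil A)

theorem inv_pencil_apply (A : Matrix ι ι ℝ) (i j : ι) :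
    (pencil A)⁻¹ i j = algebraMap (Polynomial ℝ) (RatFunc ℝ) ((charmatrix A).adjugate i j) /
      algebraMap (Polynomial ℝ) (RatFunc ℝ) A.charpoly := by
  rw [inv_def, Matrix.smul_apply, Ring.inverse_eq_inv', det_pencil, pencil_eq_map_charmatrix,
    ← RingHom.map_adjugate, smul_eq_mul, div_eq_inv_mul]
  rfl

theorem natDegree_adjugate_charmatrix_le (A : Matrix ι ι ℝ) (i j : ι) :
    ((charmatrix A).adjugate i j).natDegree ≤ Fintype.card ι := by
  have h : (charmatrix A).updateRow j (Pi.single i 1) =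
      (Polynomial.X : Polynomial ℝ) •
        ((1 : Matrix ι ι ℝ).updateRow j 0).map Polynomial.C +
        ((-A).updateRow j (Pi.single i 1)).map Polynomial.C := by
    ext1 k l
    by_cases hk : k = j
    · subst hk
      by_cases hl : l = i <;> simp [hl]
    · by_cases hkl : k = l
      · subst hkl
        simp [hk, charmatrix_apply_eq, sub_eq_add_neg]
      · simp [hk, charmatrix_apply_ne, hkl]
  rw [adjugate_apply, h]
  exact Polynomial.natDegree_det_X_add_C_le _ _

theorem entriesIn_proper_inv_pencil (A : Matrix ι ι ℝ) :
    EntriesIn properSubalgebra (pencil A)⁻¹ := by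
  intro i j
  change IsProperRat _
  rw [isProperRat_iff_intDegree_nonpos, inv_pencil_apply]
  by_cases h0 : (charmatrix A).adjugate i j = 0
  · simp [h0]
  rw [RatFunc.intDegree_div (RatFunc.algebraMap_ne_zero h0)
    (RatFunc.algebraMap_ne_zero A.charpoly_monic.ne_zero), RatFunc.intDegree_polynomial,
    RatFunc.intDegree_polynomial, charpoly_natDegree_eq_dim, sub_nonpos, Nat.cast_le]
  exact natDegree_adjugate_charmatrix_le A i j

/-- A stable matrix has its resolvent in `RH∞`. -/
theorem SchurStable.entriesIn_inv_pencil {A : Matrix ι ι ℝ} (hA : SchurStable A) :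
    EntriesIn rhInf (pencil A)⁻¹ := fun i j =>
  ⟨entriesIn_proper_inv_pencil A i j, by
    change HasStablePoles _
    rw [inv_pencil_apply]
    exact HasStablePoles.of_denom_dvd (RatFunc.denom_div_dvd _ _) hA⟩

/-- If the resolvent lies in `RH∞`, so does its determinant `1 / charpoly`, whose poles are exactly
the eigenvalues. -/
theorem SchurStable.of_entriesIn_inv_pencil {A : Matrix ι ι ℝ}
    (h : EntriesIn rhInf (pencil A)⁻¹) : SchurStable A := by
  intro z hz
  have hdet := h.det_mem
  set f := ((pencil A)⁻¹).det with hf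
  have hmul : algebraMap (Polynomial ℝ) (RatFunc ℝ) A.charpoly * f = 1 := by
    rw [← det_pencil, hf, det_nonsing_inv, Ring.mul_inverse_cancel _ (isUnit_det_pencil A)]
  have hpoly : A.charpoly * f.num = f.denom := by
    apply RatFunc.algebraMap_injective ℝ
    have h0 := RatFunc.algebraMap_ne_zero f.denom_ne_zero
    have h1 := f.num_div_denom
    rw [div_eq_iff h0] at h1
    rw [map_mul, h1, ← mul_assoc, hmul, one_mul]
  refine hdet.2 z ?_
  rw [← hpoly, map_mul, hz, zero_mul]

/-- A stabilizable and detectable realization of a transfer matrix in `RH∞` is stable: with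
`R = (zI - A)⁻¹`, output injection gives `R = M - M L (C R)` and state feedback gives
`R = N - (R B) F N`, where `M` and `N` are the resolvents of `A + L C` and `A + B F`. -/
theorem SchurStable.of_entriesIn_transfer [Fintype κ] [Fintype ν] {A : Matrix ι ι ℝ}
    {B : Matrix ι κ ℝ} {C : Matrix ν ι ℝ} {F : Matrix κ ι ℝ} {L : Matrix ι ν ℝ}
    (hF : SchurStable (A + B * F)) (hL : SchurStable (A + L * C))
    (hT : EntriesIn rhInf (constTM C * (pencil A)⁻¹ * constTM B)) : SchurStable A := by
  apply SchurStable.of_entriesIn_inv_pencil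
  have hM := hL.entriesIn_inv_pencil
  have hN := hF.entriesIn_inv_pencil
  have hLeq : (pencil A)⁻¹ = (pencil (A + L * C))⁻¹ -
      (pencil (A + L * C))⁻¹ * constTM L * (constTM C * (pencil A)⁻¹) := by
    have h : pencil (A + L * C) = pencil A - constTM L * constTM C := by
      simp only [pencil, constTM_add, constTM_mul]; abel
    have h1 : pencil (A + L * C) * (pencil A)⁻¹ =
        1 - constTM L * (constTM C * (pencil A)⁻¹) := by
      rw [h, Matrix.sub_mul, mul_nonsing_inv _ (isUnit_det_pencil A), Matrix.mul_assoc]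
    calc (pencil A)⁻¹ = (pencil (A + L * C))⁻¹ * (pencil (A + L * C) * (pencil A)⁻¹) :=
          (nonsing_inv_mul_cancel_left _ _ (isUnit_det_pencil _)).symm
      _ = _ := by rw [h1, Matrix.mul_sub, Matrix.mul_one, ← Matrix.mul_assoc]
  have hFeq : (pencil A)⁻¹ = (pencil (A + B * F))⁻¹ -
      (pencil A)⁻¹ * constTM B * (constTM F * (pencil (A + B * F))⁻¹) := by
    have h : pencil (A + B * F) = pencil A - constTM B * constTM F := by
      simp only [pencil, constTM_add, constTM_mul]; abel
    have h1 : (pencil A)⁻¹ * pencil (A + B * F) =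
        1 - (pencil A)⁻¹ * constTM B * constTM F := by
      rw [h, Matrix.mul_sub, nonsing_inv_mul _ (isUnit_det_pencil A), ← Matrix.mul_assoc]
    calc (pencil A)⁻¹ = (pencil A)⁻¹ * pencil (A + B * F) * (pencil (A + B * F))⁻¹ :=
          (mul_nonsing_inv_cancel_right _ _ (isUnit_det_pencil _)).symm
      _ = _ := by rw [h1, Matrix.sub_mul, Matrix.one_mul, Matrix.mul_assoc]
  have hRB : EntriesIn rhInf ((pencil A)⁻¹ * constTM B) := by
    have h : (pencil A)⁻¹ * constTM B = (pencil (A + L * C))⁻¹ * constTM B -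
        (pencil (A + L * C))⁻¹ * constTM L * (constTM C * (pencil A)⁻¹ * constTM B) := by
      conv_lhs => rw [hLeq]
      rw [Matrix.sub_mul, Matrix.mul_assoc _ (constTM C * _) (constTM B)]
    rw [h]
    exact (hM.mul (.const B)).sub ((hM.mul (.const L)).mul hT)
  rw [hFeq]
  exact hN.sub (hRB.mul ((EntriesIn.const F).mul hN))

end Resolvent

/-! ### Powers of stable matrices -/

section Powers

variable {ι : Type} [Fintype ι] [DecidableEq ι]

attribute [local instance] Matrix.linftyOpNormedRing Matrix.linftyOpNormedAlgebra in
/-- By Gelfand's formula the powers of `M` are eventually dominated by those of any number above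
its spectral radius. The operator norm serves only the proof: it induces the entrywise topology. -/
theorem tendsto_pow_zero_of_forall_spectrum_norm_lt_one [Nonempty ι] (M : Matrix ι ι ℂ)
    (hM : ∀ z ∈ spectrum ℂ M, ‖z‖ < 1) :
    Filter.Tendsto (fun t : ℕ => M ^ t) Filter.atTop (nhds 0) := by
  have : CompleteSpace (Matrix ι ι ℂ) := FiniteDimensional.complete ℂ _
  have hρ : spectralRadius ℂ M < (1 : NNReal) :=
    spectrum.spectralRadius_lt_of_forall_lt M fun z hz => by
      exact_mod_cast hM z hz
  obtain ⟨r, hr, hr1⟩ := ENNReal.lt_iff_exists_nnreal_btwn.1 hρ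
  have hev := (spectrum.pow_nnnorm_pow_one_div_tendsto_nhds_spectralRadius M).eventually_lt_const hr
  have hr1' : r < 1 := by exact_mod_cast hr1
  refine tendsto_zero_iff_norm_tendsto_zero.2 ?_
  refine squeeze_zero' (Filter.Eventually.of_forall fun t => norm_nonneg _) ?_
    (tendsto_pow_atTop_nhds_zero_of_lt_one r.2 hr1')
  filter_upwards [hev, Filter.eventually_gt_atTop 0] with t ht ht0
  have h1 : ((‖M ^ t‖₊ : ENNReal) ^ (1 / t : ℝ)) ^ (t : ℝ) ≤ (r : ENNReal) ^ (t : ℝ) :=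
    ENNReal.rpow_le_rpow ht.le (Nat.cast_nonneg t)
  rw [← ENNReal.rpow_mul, one_div, inv_mul_cancel₀ (by positivity), ENNReal.rpow_one,
    ENNReal.rpow_natCast] at h1
  exact_mod_cast h1

theorem map_ofReal_pow_mulVec (A : Matrix ι ι ℝ) (t : ℕ) (v : ι → ℝ) (i : ι) :
    ((A.map (algebraMap ℝ ℂ)) ^ t *ᵥ fun j => (v j : ℂ)) i = (((A ^ t) *ᵥ v) i : ℂ) := by
  have h : (A.map (algebraMap ℝ ℂ)) ^ t = (A ^ t).map (algebraMap ℝ ℂ) :=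
    (map_pow (algebraMap ℝ ℂ).mapMatrix A t).symm
  rw [h]
  simp [mulVec, dotProduct]

/-- A real matrix is stable if and only if all orbits of the linear recursion it defines converge
to zero. -/
theorem schurStable_iff_tendsto_pow_mulVec (A : Matrix ι ι ℝ) :
    SchurStable A ↔
      ∀ v : ι → ℝ, Filter.Tendsto (fun t : ℕ => (A ^ t) *ᵥ v) Filter.atTop (nhds 0) := by
  constructor
  · intro hA v
    rcases isEmpty_or_nonempty ι with _ | _
    · rw [Subsingleton.elim (fun t : ℕ => (A ^ t) *ᵥ v) fun _ => 0]
      exact tendsto_const_nhds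
    have h := tendsto_pow_zero_of_forall_spectrum_norm_lt_one (A.map (algebraMap ℝ ℂ))
      fun z hz => hA z ((mem_spectrum_map_iff_aeval_charpoly A z).1 hz)
    rw [tendsto_pi_nhds]
    intro i
    have hc : Continuous fun M : Matrix ι ι ℂ => ((M *ᵥ fun j => (v j : ℂ)) i).re := by fun_prop
    have h2 := (hc.tendsto 0).comp h
    simpa only [Function.comp_def, map_ofReal_pow_mulVec, Complex.ofReal_re, zero_mulVec,
      Pi.zero_apply, Complex.zero_re] using h2
  · intro h z hz
    rw [← mem_spectrum_map_iff_aeval_charpoly, ← spectrum_toLin',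
      ← Module.End.hasEigenvalue_iff_mem_spectrum] at hz
    obtain ⟨w, hw⟩ := hz.exists_hasEigenvector
    have hpow : ∀ t : ℕ, (A.map (algebraMap ℝ ℂ)) ^ t *ᵥ w = z ^ t • w := fun t => by
      have := hw.pow_apply t
      rwa [← toLin'_pow, toLin'_apply] at this
    obtain ⟨i, hi⟩ := Function.ne_iff.1 hw.2
    -- The orbit of the complex eigenvector converges because those of its real and imaginary
    -- parts do.
    have hsplit : w = (fun j => ((w j).re : ℂ)) + Complex.I • fun j => ((w j).im : ℂ) := by
      ext j
      simp [mul_comm Complex.I, Complex.re_add_im]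
    have hre := tendsto_pi_nhds.1 (h fun j => (w j).re) i
    have him := tendsto_pi_nhds.1 (h fun j => (w j).im) i
    have hlim : Filter.Tendsto (fun t : ℕ => z ^ t * w i) Filter.atTop (nhds 0) := by
      have h1 := ((Complex.continuous_ofReal.tendsto _).comp hre).add
        (((Complex.continuous_ofReal.tendsto _).comp him).const_mul Complex.I)
      simp only [Pi.zero_apply, Complex.ofReal_zero, mul_zero, add_zero] at h1
      refine h1.congr fun t => ?_
      have h2 := congrFun (hpow t) i
      rw [Pi.smul_apply, smul_eq_mul] at h2
      rw [← h2]
      conv_rhs => rw [hsplit]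
      rw [mulVec_add, mulVec_smul, Pi.add_apply, Pi.smul_apply, map_ofReal_pow_mulVec,
        map_ofReal_pow_mulVec]
      rfl
    have hz0 : Filter.Tendsto (fun t : ℕ => z ^ t) Filter.atTop (nhds 0) := by
      have := hlim.mul_const (w i)⁻¹
      simpa [mul_assoc, mul_inv_cancel₀ hi] using this
    exact tendsto_pow_atTop_nhds_zero_iff_norm_lt_one.1 hz0

end Powers

namespace FeedbackSystem

variable {n m p q : ℕ} (S : FeedbackSystem n m p q)

/-! ### The closed-loop state matrix -/

/-- The state matrix of the undisturbed closed loop, acting on the joint state `(x, ξ)`. -/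
def closedLoopMatrix : Matrix (Fin n ⊕ Fin q) (Fin n ⊕ Fin q) ℝ :=
  fromBlocks (S.A + S.B * S.Dk * S.C) (S.B * S.Ck) (S.Bk * S.C) S.Ak

/-- The input matrix of the closed loop for the disturbances `(δy, δu)`. -/
def closedLoopInput : Matrix (Fin n ⊕ Fin q) (Fin p ⊕ Fin m) ℝ :=
  fromBlocks (S.B * S.Dk) S.B S.Bk 0

/-- The output matrix of the closed loop for the signals `(y, u)`. -/
def closedLoopOutput : Matrix (Fin p ⊕ Fin m) (Fin n ⊕ Fin q) ℝ :=
  fromBlocks S.C 0 (S.Dk * S.C) S.Ck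

theorem pencil_closedLoopMatrix : pencil S.closedLoopMatrix =
    fromBlocks (pencil (S.A + S.B * S.Dk * S.C)) (-(constTM S.B * constTM S.Ck))
      (-(constTM S.Bk * constTM S.C)) (pencil S.Ak) := by
  rw [pencil, closedLoopMatrix, constTM_fromBlocks, ← fromBlocks_one, fromBlocks_smul, smul_zero,
    smul_zero, sub_eq_add_neg, fromBlocks_neg, fromBlocks_add, zero_add, zero_add, constTM_mul S.B,
    constTM_mul S.Bk, pencil, pencil, sub_eq_add_neg, sub_eq_add_neg]

/-- The matrix `zI - A - B K C` is the Schur complement of `zI - Ak` in the closed-loop pencil. -/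
theorem closedLoopPencil_eq_schur_complement : S.closedLoopPencil =
    pencil (S.A + S.B * S.Dk * S.C) -
      -(constTM S.B * constTM S.Ck) * (pencil S.Ak)⁻¹ * -(constTM S.Bk * constTM S.C) := by
  have hK : S.K = constTM S.Ck * (pencil S.Ak)⁻¹ * constTM S.Bk + constTM S.Dk := rfl
  rw [closedLoopPencil, hK, pencil.eq_def (S.A + _), constTM_add, constTM_mul, constTM_mul]
  simp only [Matrix.mul_add, Matrix.add_mul, Matrix.neg_mul, Matrix.mul_neg, neg_neg,
    Matrix.mul_assoc]
  abel

theorem isUnit_closedLoopPencil : IsUnit S.closedLoopPencil := by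
  have := (isUnit_pencil S.Ak).invertible
  have h := isUnit_pencil S.closedLoopMatrix
  rw [pencil_closedLoopMatrix, isUnit_fromBlocks_iff_of_invertible₂₂, invOf_eq_nonsing_inv] at h
  rwa [closedLoopPencil_eq_schur_complement]

theorem inv_pencil_closedLoopMatrix : (pencil S.closedLoopMatrix)⁻¹ =
    fromBlocks S.Φxx (S.Φxx * (constTM S.B * constTM S.Ck) * (pencil S.Ak)⁻¹)
      ((pencil S.Ak)⁻¹ * (constTM S.Bk * constTM S.C) * S.Φxx)
      ((pencil S.Ak)⁻¹ + (pencil S.Ak)⁻¹ * (constTM S.Bk * constTM S.C) * S.Φxx *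
        (constTM S.B * constTM S.Ck) * (pencil S.Ak)⁻¹) := by
  have h1 := (isUnit_pencil S.Ak).invertible
  have h2 := (isUnit_pencil S.closedLoopMatrix).invertible
  have h3 := S.isUnit_closedLoopPencil.invertible
  rw [Φxx]
  rw [closedLoopPencil_eq_schur_complement, ← invOf_eq_nonsing_inv (pencil S.Ak)] at h3 ⊢
  rw [pencil_closedLoopMatrix] at h2 ⊢
  rw [← invOf_eq_nonsing_inv, invOf_fromBlocks₂₂_eq]
  simp only [Matrix.mul_neg, Matrix.neg_mul, neg_neg, invOf_eq_nonsing_inv]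

/-- State-space realization of the responses from `(δy, δu)` to `(y, u)`. -/
theorem groupYUtoYU_eq : S.groupYUtoYU =
    constTM S.closedLoopOutput * (pencil S.closedLoopMatrix)⁻¹ * constTM S.closedLoopInput +
      constTM (fromBlocks 1 0 S.Dk 1) := by
  have hK : S.K = constTM S.Ck * (pencil S.Ak)⁻¹ * constTM S.Bk + constTM S.Dk := rfl
  rw [inv_pencil_closedLoopMatrix, closedLoopOutput, closedLoopInput, constTM_fromBlocks,
    constTM_fromBlocks, constTM_fromBlocks, fromBlocks_multiply, fromBlocks_multiply,
    fromBlocks_add, groupYUtoYU, Φyy, Φyu, Φuy, Φuu, hK]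
  simp only [constTM_zero, constTM_one, constTM_mul, Matrix.mul_add, Matrix.add_mul,
    Matrix.mul_assoc, Matrix.mul_zero, Matrix.zero_mul, Matrix.mul_one, add_zero]
  congr 1 <;> abel

/-- All closed-loop responses are polynomial expressions in constant matrices and the resolvent of
the closed-loop state matrix, so they have entries in every subalgebra containing those of the
resolvent. -/
theorem entriesIn_responses {P : Subalgebra ℝ (RatFunc ℝ)}
    (h : EntriesIn P (pencil S.closedLoopMatrix)⁻¹) :
    EntriesIn P S.Φxx ∧ EntriesIn P S.Φxy ∧ EntriesIn P S.Φxu ∧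
      EntriesIn P S.Φyx ∧ EntriesIn P S.Φyy ∧ EntriesIn P S.Φyu ∧
      EntriesIn P S.Φux ∧ EntriesIn P S.Φuy ∧ EntriesIn P S.Φuu := by
  have hYU : EntriesIn P S.groupYUtoYU := by
    rw [groupYUtoYU_eq]
    exact (((EntriesIn.const _).mul h).mul (.const _)).add (.const _)
  obtain ⟨hyy, hyu, huy, huu⟩ := EntriesIn.fromBlocks_iff.1 hYU
  rw [inv_pencil_closedLoopMatrix] at h
  obtain ⟨hxx, h12, h21, -⟩ := EntriesIn.fromBlocks_iff.1 h
  have hK : S.K = constTM S.Ck * (pencil S.Ak)⁻¹ * constTM S.Bk + constTM S.Dk := rfl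
  have hxy : S.Φxy = S.Φxx * (constTM S.B * constTM S.Ck) * (pencil S.Ak)⁻¹ * constTM S.Bk +
      S.Φxx * constTM S.B * constTM S.Dk := by
    rw [Φxy, hK]
    simp only [Matrix.mul_add, Matrix.mul_assoc]
  have hux : S.Φux = constTM S.Ck * ((pencil S.Ak)⁻¹ * (constTM S.Bk * constTM S.C) * S.Φxx) +
      constTM S.Dk * constTM S.C * S.Φxx := by
    rw [Φux, hK]
    simp only [Matrix.add_mul, Matrix.mul_assoc]
  have hxu : EntriesIn P S.Φxu := hxx.mul (.const _)
  refine ⟨hxx, ?_, hxu, (EntriesIn.const _).mul hxx, hyy, hyu, ?_, huy, huu⟩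
  · rw [hxy]
    exact (h12.mul (.const _)).add (hxu.mul (.const _))
  · rw [hux]
    exact ((EntriesIn.const _).mul h21).add (((EntriesIn.const _).mul (.const _)).mul hxx)

/-- Since the plant is strictly proper, the closed loop is always well-posed. -/
theorem wellPosed : S.WellPosed :=
  ⟨S.isUnit_closedLoopPencil,
    S.entriesIn_responses (entriesIn_proper_inv_pencil S.closedLoopMatrix)⟩

/-! ### Internal stability -/

variable {S} in
theorem IsTrajectory.eq_pow_mulVec {x : ℕ → Fin n → ℝ} {ξ : ℕ → Fin q → ℝ} {u : ℕ → Fin m → ℝ}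
    {y : ℕ → Fin p → ℝ} (h : S.IsTrajectory 0 0 0 x ξ u y) (t : ℕ) :
    Sum.elim (x t) (ξ t) = (S.closedLoopMatrix ^ t) *ᵥ Sum.elim (x 0) (ξ 0) := by
  induction t with
  | zero => simp
  | succ t ih =>
    rw [pow_succ', ← mulVec_mulVec, ← ih, closedLoopMatrix, fromBlocks_mulVec,
      h.plant_state, h.controller_state, h.controller_output, h.plant_output]
    simp only [Sum.elim_comp_inl, Sum.elim_comp_inr, Pi.zero_apply, add_zero, mulVec_add,
      add_mulVec, mulVec_mulVec, Matrix.mul_assoc]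
    congr 1 <;> abel

theorem exists_isTrajectory (x₀ : Fin n → ℝ) (ξ₀ : Fin q → ℝ) :
    ∃ x ξ u y, S.IsTrajectory 0 0 0 x ξ u y ∧ x 0 = x₀ ∧ ξ 0 = ξ₀ := by
  let s : ℕ → (Fin n → ℝ) × (Fin q → ℝ) := fun t =>
    Nat.rec (x₀, ξ₀) (fun _ s => (S.A *ᵥ s.1 + S.B *ᵥ (S.Ck *ᵥ s.2 + S.Dk *ᵥ (S.C *ᵥ s.1)),
      S.Ak *ᵥ s.2 + S.Bk *ᵥ (S.C *ᵥ s.1))) t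
  refine ⟨fun t => (s t).1, fun t => (s t).2,
    fun t => S.Ck *ᵥ (s t).2 + S.Dk *ᵥ (S.C *ᵥ (s t).1), fun t => S.C *ᵥ (s t).1,
    ⟨fun t => ?_, fun t => ?_, fun t => rfl, fun t => ?_⟩, rfl, rfl⟩
  all_goals simp [s]

theorem internallyStable_iff_schurStable : S.InternallyStable ↔ SchurStable S.closedLoopMatrix := by
  rw [schurStable_iff_tendsto_pow_mulVec, InternallyStable, and_iff_right S.wellPosed]
  constructor
  · intro h v
    obtain ⟨x, ξ, u, y, htraj, hx, hξ⟩ := S.exists_isTrajectory (v ∘ Sum.inl) (v ∘ Sum.inr)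
    have hlim := h x ξ u y htraj
    have heq : ∀ t, (S.closedLoopMatrix ^ t) *ᵥ v = Sum.elim (x t) (ξ t) := fun t => by
      rw [htraj.eq_pow_mulVec, hx, hξ, Sum.elim_comp_inl_inr]
    simp only [heq]
    rw [nhds_prod_eq, Filter.tendsto_prod_iff'] at hlim
    rw [tendsto_pi_nhds]
    rintro (i | i)
    · exact tendsto_pi_nhds.1 hlim.1 i
    · exact tendsto_pi_nhds.1 hlim.2 i
  · intro h x ξ u y htraj
    have hlim := h (Sum.elim (x 0) (ξ 0))
    simp only [← htraj.eq_pow_mulVec] at hlim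
    rw [tendsto_pi_nhds] at hlim
    exact (tendsto_pi_nhds.2 fun i => hlim (Sum.inl i)).prodMk_nhds
      (tendsto_pi_nhds.2 fun i => hlim (Sum.inr i))

/-- The realization `(closedLoopMatrix, closedLoopInput, closedLoopOutput)` inherits stabilizability
and detectability from plant and controller: static input and output transformations decouple the
two, after which their own feedback and injection gains apply. -/
theorem schurStable_closedLoopMatrix_of_groupYUtoYU (hS : S.StabilizableDetectable)
    (h : MemRHInf S.groupYUtoYU) : SchurStable S.closedLoopMatrix := by
  obtain ⟨⟨F, hF⟩, ⟨Fk, hFk⟩, ⟨L, hL⟩, ⟨Lk, hLk⟩⟩ := hS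
  rw [isStableMatrix_iff_schurStable] at hF hFk hL hLk
  refine SchurStable.of_entriesIn_transfer (B := S.closedLoopInput) (C := S.closedLoopOutput)
    (F := fromBlocks (-S.C) Fk F (-S.Ck - S.Dk * Fk))
    (L := fromBlocks L (-S.B) (-S.Bk - Lk * S.Dk) Lk) ?_ ?_ ?_
  · -- `𝒜 + 𝓑 𝓕 = diag(A + B F, Ak + Bk Fk)`
    convert! hF.fromBlocks_diagonal hFk using 1
    rw [closedLoopMatrix, closedLoopInput, fromBlocks_multiply, fromBlocks_add]
    simp only [Matrix.mul_neg, Matrix.mul_sub, Matrix.zero_mul, Matrix.mul_assoc]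
    congr 1 <;> abel
  · -- `𝒜 + 𝓛 𝒞 = diag(A + L C, Ak + Lk Ck)`
    convert! hL.fromBlocks_diagonal hLk using 1
    rw [closedLoopMatrix, closedLoopOutput, fromBlocks_multiply, fromBlocks_add]
    simp only [Matrix.neg_mul, Matrix.sub_mul, Matrix.mul_zero, Matrix.mul_assoc]
    congr 1 <;> abel
  · have h' : EntriesIn rhInf (S.groupYUtoYU - constTM (fromBlocks 1 0 S.Dk 1)) :=
      EntriesIn.sub h (.const _)
    rwa [groupYUtoYU_eq, add_sub_cancel_right] at h'

theorem memRHInf_groupXYtoYU_of_groupXYtoXU (h : MemRHInf S.groupXYtoXU) :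
    MemRHInf S.groupXYtoYU := by
  obtain ⟨hxx, hxy, hux, huy⟩ := memRHInf_fromBlocks_iff.1 h
  refine memRHInf_fromBlocks_iff.2 ⟨(EntriesIn.const _).mul hxx, ?_, hux, huy⟩
  rw [Φyy, Matrix.mul_assoc, Matrix.mul_assoc, ← Matrix.mul_assoc S.Φxx]
  exact ((EntriesIn.const _).mul hxy).add .one

theorem memRHInf_groupYUtoYU_of_groupXYtoYU (h : MemRHInf S.groupXYtoYU) :
    MemRHInf S.groupYUtoYU := by
  obtain ⟨hyx, hyy, hux, huy⟩ := memRHInf_fromBlocks_iff.1 h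
  exact memRHInf_fromBlocks_iff.2
    ⟨hyy, hyx.mul (.const _), huy, (hux.mul (.const _)).add .one⟩

theorem memRHInf_groupYUtoYU_of_groupYUtoXU (h : MemRHInf S.groupYUtoXU) :
    MemRHInf S.groupYUtoYU := by
  obtain ⟨hxy, hxu, huy, huu⟩ := memRHInf_fromBlocks_iff.1 h
  refine memRHInf_fromBlocks_iff.2 ⟨?_, ?_, huy, huu⟩
  · rw [Φyy, Matrix.mul_assoc, Matrix.mul_assoc, ← Matrix.mul_assoc S.Φxx]
    exact ((EntriesIn.const _).mul hxy).add .one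
  · rw [Φyu, Matrix.mul_assoc]
    exact (EntriesIn.const _).mul hxu

theorem tfae_internallyStable (hS : S.StabilizableDetectable) :
    List.TFAE [S.InternallyStable, MemRHInf S.groupXYtoYU, MemRHInf S.groupXYtoXU,
      MemRHInf S.groupYUtoYU, MemRHInf S.groupYUtoXU] := by
  tfae_have 1 → 3 := fun h => by
    obtain ⟨hxx, hxy, -, -, -, -, hux, huy, -⟩ := S.entriesIn_responses
      (S.internallyStable_iff_schurStable.1 h).entriesIn_inv_pencil
    exact memRHInf_fromBlocks_iff.2 ⟨hxx, hxy, hux, huy⟩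
  tfae_have 1 → 5 := fun h => by
    obtain ⟨-, hxy, hxu, -, -, -, -, huy, huu⟩ := S.entriesIn_responses
      (S.internallyStable_iff_schurStable.1 h).entriesIn_inv_pencil
    exact memRHInf_fromBlocks_iff.2 ⟨hxy, hxu, huy, huu⟩
  tfae_have 3 → 2 := S.memRHInf_groupXYtoYU_of_groupXYtoXU
  tfae_have 2 → 4 := S.memRHInf_groupYUtoYU_of_groupXYtoYU
  tfae_have 5 → 4 := S.memRHInf_groupYUtoYU_of_groupYUtoXU
  tfae_have 4 → 1 := fun h => S.internallyStable_iff_schurStable.2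
    (S.schurStable_closedLoopMatrix_of_groupYUtoYU hS h)
  tfae_finish

/-! ### An unstable controller hidden from the plant -/

/-- If the controller output does not reach the plant (`B K = 0`) and the plant output does not
reach the controller (`K C = 0`), then the eight responses other than `Φuy` do not involve the
controller dynamics. -/
theorem memRHInf_groups_of_decoupled (hA : IsStableMatrix S.A) (hBK : constTM S.B * S.K = 0)
    (hKC : S.K * constTM S.C = 0) :
    MemRHInf S.groupXYtoXY ∧ MemRHInf S.groupYUtoXY ∧ MemRHInf S.groupXUtoXY ∧
      MemRHInf S.groupXUtoYU ∧ MemRHInf S.groupXUtoXU := by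
  have hxx : EntriesIn rhInf S.Φxx := by
    rw [Φxx, closedLoopPencil, hBK, Matrix.zero_mul, sub_zero]
    exact ((isStableMatrix_iff_schurStable _).1 hA).entriesIn_inv_pencil
  have hxy : EntriesIn rhInf S.Φxy := by
    rw [Φxy, Matrix.mul_assoc, hBK, Matrix.mul_zero]
    exact .zero
  have hxu : EntriesIn rhInf S.Φxu := hxx.mul (.const _)
  have hyx : EntriesIn rhInf S.Φyx := (EntriesIn.const _).mul hxx
  have hyy : EntriesIn rhInf S.Φyy := by
    rw [Φyy, Matrix.mul_assoc, hBK, Matrix.mul_zero, zero_add]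
    exact .one
  have hyu : EntriesIn rhInf S.Φyu := hyx.mul (.const _)
  have hux : EntriesIn rhInf S.Φux := by
    rw [Φux, hKC, Matrix.zero_mul]
    exact .zero
  have huu : EntriesIn rhInf S.Φuu := (hux.mul (.const _)).add .one
  exact ⟨memRHInf_fromBlocks_iff.2 ⟨hxx, hxy, hyx, hyy⟩,
    memRHInf_fromBlocks_iff.2 ⟨hxy, hxu, hyy, hyu⟩,
    memRHInf_fromBlocks_iff.2 ⟨hxx, hxu, hyx, hyu⟩,
    memRHInf_fromBlocks_iff.2 ⟨hyx, hyu, hux, huu⟩,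
    memRHInf_fromBlocks_iff.2 ⟨hxx, hxu, hux, huu⟩⟩

/-- The plant `G = diag(1/z, 0)` uses the first input and the first output, while the unstable
controller `K = diag(0, 1/(z - 2))` uses the second input and the second output. -/
def hiddenController : FeedbackSystem 1 2 2 1 where
  A := 0
  B := !![1, 0]
  C := !![1; 0]
  Ak := !![2]
  Bk := !![0, 1]
  Ck := !![0; 1]
  Dk := 0

theorem isStableMatrix_zero {k : ℕ} : IsStableMatrix (0 : Matrix (Fin k) (Fin k) ℝ) := by
  rw [isStableMatrix_iff_schurStable]
  intro z hz
  rw [charpoly_zero, map_pow, Polynomial.aeval_X] at hz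
  simp [eq_zero_of_pow_eq_zero hz]

theorem hiddenController_stabilizableDetectable : hiddenController.StabilizableDetectable := by
  refine ⟨⟨0, ?_⟩, ⟨!![0; -2], ?_⟩, ⟨0, ?_⟩, ⟨!![0, -2], ?_⟩⟩
  all_goals
    convert! isStableMatrix_zero (k := 1) using 1
    ext i j
    fin_cases i; fin_cases j
    simp [hiddenController]

theorem hiddenController_B_mul_Ck : hiddenController.B * hiddenController.Ck = 0 := by
  ext i j
  simp [hiddenController]

theorem hiddenController_Bk_mul_C : hiddenController.Bk * hiddenController.C = 0 := by
  ext i j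
  simp [hiddenController]

theorem hiddenController_memRHInf :
    MemRHInf hiddenController.groupXYtoXY ∧ MemRHInf hiddenController.groupYUtoXY ∧
      MemRHInf hiddenController.groupXUtoXY ∧ MemRHInf hiddenController.groupXUtoYU ∧
      MemRHInf hiddenController.groupXUtoXU := by
  have hDk : constTM hiddenController.Dk = 0 := constTM_zero
  refine hiddenController.memRHInf_groups_of_decoupled isStableMatrix_zero ?_ ?_
  · rw [K, hDk, add_zero, ← Matrix.mul_assoc, ← Matrix.mul_assoc, ← constTM_mul,
      hiddenController_B_mul_Ck, constTM_zero, Matrix.zero_mul, Matrix.zero_mul]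
  · rw [K, hDk, add_zero, Matrix.mul_assoc, ← constTM_mul, hiddenController_Bk_mul_C,
      constTM_zero, Matrix.mul_zero]

theorem not_internallyStable_hiddenController : ¬ hiddenController.InternallyStable := by
  rw [internallyStable_iff_schurStable]
  intro h
  -- The closed-loop matrix is `diag(0, 2)`, so `2` is an eigenvalue.
  have h2 : Polynomial.aeval (2 : ℂ) hiddenController.closedLoopMatrix.charpoly = 0 := by
    rw [closedLoopMatrix, hiddenController_B_mul_Ck, charpoly_fromBlocks_zero₁₂, map_mul]
    simp [hiddenController, charpoly, charmatrix]
  have := h 2 h2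
  norm_num at this

end FeedbackSystem

theorem theorem1 :
    (∀ (n m p q : ℕ) (S : FeedbackSystem n m p q), S.StabilizableDetectable →
      List.TFAE [
        S.InternallyStable,
        MemRHInf S.groupXYtoYU,
        MemRHInf S.groupXYtoXU,
        MemRHInf S.groupYUtoYU,
        MemRHInf S.groupYUtoXU]) ∧
    (∃ (n m p q : ℕ) (S : FeedbackSystem n m p q), 0 < n ∧ 0 < m ∧ 0 < p ∧ 0 < q ∧
      S.StabilizableDetectable ∧ MemRHInf S.groupXYtoXY ∧ ¬ S.InternallyStable) ∧
    (∃ (n m p q : ℕ) (S : FeedbackSystem n m p q), 0 < n ∧ 0 < m ∧ 0 < p ∧ 0 < q ∧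
      S.StabilizableDetectable ∧ MemRHInf S.groupYUtoXY ∧ ¬ S.InternallyStable) ∧
    (∃ (n m p q : ℕ) (S : FeedbackSystem n m p q), 0 < n ∧ 0 < m ∧ 0 < p ∧ 0 < q ∧
      S.StabilizableDetectable ∧ MemRHInf S.groupXUtoXY ∧ ¬ S.InternallyStable) ∧
    (∃ (n m p q : ℕ) (S : FeedbackSystem n m p q), 0 < n ∧ 0 < m ∧ 0 < p ∧ 0 < q ∧
      S.StabilizableDetectable ∧ MemRHInf S.groupXUtoYU ∧ ¬ S.InternallyStable) ∧
    (∃ (n m p q : ℕ) (S : FeedbackSystem n m p q), 0 < n ∧ 0 < m ∧ 0 < p ∧ 0 < q ∧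
      S.StabilizableDetectable ∧ MemRHInf S.groupXUtoXU ∧ ¬ S.InternallyStable) := by
  obtain ⟨h1, h2, h3, h4, h5⟩ := FeedbackSystem.hiddenController_memRHInf
  have hS := FeedbackSystem.hiddenController_stabilizableDetectable
  have hI := FeedbackSystem.not_internallyStable_hiddenController
  exact ⟨fun n m p q S hS => S.tfae_internallyStable hS,
    ⟨1, 2, 2, 1, _, one_pos, two_pos, two_pos, one_pos, hS, h1, hI⟩,
    ⟨1, 2, 2, 1, _, one_pos, two_pos, two_pos, one_pos, hS, h2, hI⟩,
    ⟨1, 2, 2, 1, _, one_pos, two_pos, two_pos, one_pos, hS, h3, hI⟩,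
    ⟨1, 2, 2, 1, _, one_pos, two_pos, two_pos, one_pos, hS, h4, hI⟩,
    ⟨1, 2, 2, 1, _, one_pos, two_pos, two_pos, one_pos, hS, h5, hI⟩⟩
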